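/- \textbf{Theorem (No Randomness Ex Nihilo for computable semi-measures).} Notation. For a finite binary string $\sigma$ let $[\![\sigma]\!]\subseteq 2^\omega$ be the set of infinite binary sequences that have $\sigma$ as an initial segment; for $S\subseteq 2^{<\omega}$ let $[\![S]\!]=\bigcup_{\sigma\in S}[\![\sigma]\!]$. Write $\sigma\preceq\tau$ if $\sigma$ is an initial segment of $\tau$, where $\tau$ is a finite or infinite sequence. Let $\varepsilon$ be the empty string and let $\lambda$ be the uniform (Lebesgue) measure on $2^\omega$. A \emph{Turing functional} $\Phi$ is a c.e. set of pairs of finite binary strings such that if $(\sigma,\tau),(\sigma',\tau')\in\Phi$ and $\sigma\preceq\sigma'$, then $\tau\preceq\tau'$ or $\tau'\preceq\tau$. For $X\in 2^\omega$, $\Phi^X$ is the shortest finite or infinite binary sequence that extends every $\tau$ such that $(\sigma,\tau)\in\Phi$ for some $\sigma\preceq X$ (it is empty if there is no such $\tau$). If $\Phi^X$ is infinite, $\Phi(X)$ is defined and $\Phi(X)=\Phi^X$; otherwise $\Phi(X)$ is undefined. $\Phi$ \emph{induces} the function $\lambda_\Phi(\sigma)=\lambda(\{X\in 2^\omega:\sigma\preceq\Phi^X\})$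 on $2^{<\omega}$. A \emph{semi-measure} is a function $\rho:2^{<\omega}\to[0,1]$ with $\rho(\varepsilon)=1$ and $\rho(\sigma)\ge\rho(\sigma0)+\rho(\sigma1)$ for all $\sigma$. It is \emph{computable} if there is a computable function $\tilde\rho$ from $2^{<\omega}\times\omega$ to the non-negative dyadic rationals with $|\rho(\sigma)-\tilde\rho(\sigma,i)|\le 2^{-i}$ for all $\sigma$ and $i$. For $E\subseteq 2^{<\omega}$ put $\rho(E)=\sum_{\sigma\in E}\rho(\sigma)$. A sequence $Y\in 2^\omega$ is \emph{$\rho$-Martin-L\"of random} if $Y\notin\bigcap_{i}[\![U_i]\!]$ for every uniformly c.e. sequence $(U_i)_{i\in\omega}$ of subsets of $2^{<\omega}$ with $\rho(U_i)\le 2^{-i}$ for all $i$. A sequence $X\in 2^\omega$ is \emph{Martin-L\"of random} if $X\notin\bigcap_{i}[\![U_i]\!]$ for every uniformly c.e. sequence $(U_i)_{i\in\omega}$ of subsets of $2^{<\omega}$ with $\lambda([\![U_i]\!])\le 2^{-i}$ for all $i$. Statement. Let $\Phi$ be a Turing functional that induces a computable semi-measure $\rho$, that is, $\lambda_\Phi=\rho$.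 If $Y\in 2^\omega$ is $\rho$-Martin-L\"of random, then there is a Martin-L\"of random $X\in 2^\omega$ such that $\Phi(X)$ is defined and $\Phi(X)=Y$. -/

import Mathlib

open MeasureTheory
open scoped ENNReal

/-- Cantor space `2^ω`. -/
abbrev Cantor : Type := ℕ → Bool

/-- Finite binary strings `2^{<ω}`. -/
abbrev BinStr : Type := List Bool

/-- `X ↾ n`, the string of the first `n` bits of `X`. -/
def initSeg (X : Cantor) (n : ℕ) : BinStr := (List.range n).map X

/-- The cylinder `⟦σ⟧`, the set of sequences that have `σ` as an initial segment. -/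
def strCylinder (σ : BinStr) : Set Cantor := {X | initSeg X σ.length = σ}

/-- `⟦S⟧`, the union of the cylinders `⟦σ⟧` with `σ ∈ S`. -/
def openOf (S : Set BinStr) : Set Cantor := ⋃ σ ∈ S, strCylinder σ

/-- The uniform (Lebesgue) measure `λ` on `2^ω`: independent fair coin tosses. -/
noncomputable def uniformMeasure : Measure Cantor :=
  Measure.infinitePi fun _ : ℕ => (PMF.uniformOfFintype Bool).toMeasure

/-- A sequence of uniformly c.e. sets of strings. -/
def UniformlyCE (U : ℕ → Set BinStr) : Prop :=
  REPred fun p : ℕ × BinStr => p.2 ∈ U p.1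

/-- The Martin-Löf random sequences (with respect to the uniform measure): those that are in
`⋂ i, ⟦U i⟧` for no uniformly c.e. `U` with `λ ⟦U i⟧ ≤ 2^{-i}` for all `i`. -/
def MLR : Set Cantor :=
  {X | ∀ U : ℕ → Set BinStr, UniformlyCE U →
    (∀ i, uniformMeasure (openOf (U i)) ≤ (2⁻¹ : ℝ≥0∞) ^ i) → X ∉ ⋂ i, openOf (U i)}

/-- A semi-measure `ρ : 2^{<ω} → [0,1]`. -/
structure IsSemimeasure (ρ : BinStr → ℝ) : Prop where
  mem_unit : ∀ σ, ρ σ ∈ Set.Icc (0 : ℝ) 1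
  root : ρ [] = 1
  superadd : ∀ σ, ρ (σ ++ [false]) + ρ (σ ++ [true]) ≤ ρ σ

/-- A computable semi-measure: there is a computable function, with values in the non-negative
dyadic rationals, that approximates `ρ σ` up to `2^{-i}`.  The pair `(m, n)` stands for the
dyadic rational `m / 2^n`. -/
structure IsComputableSemimeasure (ρ : BinStr → ℝ) : Prop extends IsSemimeasure ρ where
  approx : ∃ f : BinStr × ℕ → ℕ × ℕ, Computable f ∧
    ∀ σ i, |ρ σ - ((f (σ, i)).1 : ℝ) / (2 : ℝ) ^ (f (σ, i)).2| ≤ (1 / 2 : ℝ) ^ i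

/-- `ρ(E) = ∑_{σ ∈ E} ρ(σ)`, a sum of non-negative terms in `[0,∞]`. -/
noncomputable def semimeasureOf (ρ : BinStr → ℝ) (E : Set BinStr) : ℝ≥0∞ :=
  ∑' σ : E, ENNReal.ofReal (ρ σ)

/-- The `ρ`-Martin-Löf random sequences: those that are in `⋂ i, ⟦U i⟧` for no uniformly c.e.
`U` with `ρ(U i) ≤ 2^{-i}` for all `i`. -/
def SemimeasureMLR (ρ : BinStr → ℝ) : Set Cantor :=
  {X | ∀ U : ℕ → Set BinStr, UniformlyCE U →
    (∀ i, semimeasureOf ρ (U i) ≤ (2⁻¹ : ℝ≥0∞) ^ i) → X ∉ ⋂ i, openOf (U i)}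

/-- A Turing functional: a c.e. set of pairs of strings such that pairs with comparable
(in particular, equal) first entries have comparable second entries. -/
structure TuringFunctional where
  pairs : Set (BinStr × BinStr)
  ce : REPred fun p : BinStr × BinStr => p ∈ pairs
  consistent : ∀ σ τ σ' τ' : BinStr, (σ, τ) ∈ pairs → (σ', τ') ∈ pairs → σ <+: σ' →
    τ <+: τ' ∨ τ' <+: τ

namespace TuringFunctional

/-- The finite or infinite sequence `Φ^X`, given by the set of its finite initial segments:
it is the shortest sequence that extends every `τ` such that `(σ, τ) ∈ Φ` for some initial
segment `σ` of `X`.  (It is empty if there is no such `τ`.)  So `τ ∈ Φ.output X` says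
`Φ^X ⪰ τ`. -/
def output (Φ : TuringFunctional) (X : Cantor) : Set BinStr :=
  {τ | τ = [] ∨ ∃ σ τ', (σ, τ') ∈ Φ.pairs ∧ X ∈ strCylinder σ ∧ τ <+: τ'}

/-- The partial map `Φ : ⊆ 2^ω → 2^ω`.  It is defined at `X` if `Φ^X` is infinite, and its value
is then the sequence `Y` whose initial segments are those of `Φ^X`. -/
noncomputable def eval (Φ : TuringFunctional) : Cantor →. Cantor :=
  fun X => ⟨∃ Y : Cantor, ∀ n, initSeg Y n ∈ Φ.output X, fun h => h.choose⟩

theorem output_comparable (Φ : TuringFunctional) {X : Cantor} {τ₁ τ₂ : BinStr}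
    (h₁ : τ₁ ∈ Φ.output X) (h₂ : τ₂ ∈ Φ.output X) : τ₁ <+: τ₂ ∨ τ₂ <+: τ₁ := by
  rcases h₁ with rfl | ⟨σ₁, τ₁', hp₁, hX₁, ht₁⟩
  · exact Or.inl List.nil_prefix
  rcases h₂ with rfl | ⟨σ₂, τ₂', hp₂, hX₂, ht₂⟩
  · exact Or.inr List.nil_prefix
  have key : ∀ {m n : ℕ}, m ≤ n → initSeg X m <+: initSeg X n := by
    intro m n hmn
    obtain ⟨k, rfl⟩ := Nat.exists_eq_add_of_le hmn
    simp [initSeg, List.range_add]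
  have hcmp : τ₁' <+: τ₂' ∨ τ₂' <+: τ₁' := by
    rcases le_total σ₁.length σ₂.length with h | h
    · have := key h
      rw [hX₁, hX₂] at this
      exact Φ.consistent _ _ _ _ hp₁ hp₂ this
    · have := key h
      rw [hX₁, hX₂] at this
      exact (Φ.consistent _ _ _ _ hp₂ hp₁ this).symm
  rcases hcmp with h | h
  · exact List.prefix_or_prefix_of_prefix (ht₁.trans h) ht₂
  · exact List.prefix_or_prefix_of_prefix ht₁ (ht₂.trans h)

theorem mem_eval_iff (Φ : TuringFunctional) (X Y : Cantor) :
    Y ∈ Φ.eval X ↔ ∀ n, initSeg Y n ∈ Φ.output X := by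
  constructor
  · rintro ⟨h, rfl⟩
    exact h.choose_spec
  · intro hY
    have h : ∃ Y : Cantor, ∀ n, initSeg Y n ∈ Φ.output X := ⟨Y, hY⟩
    refine ⟨h, ?_⟩
    change h.choose = Y
    funext n
    have hlen : (initSeg h.choose (n + 1)).length = (initSeg Y (n + 1)).length := by
      simp [initSeg]
    have heq : initSeg h.choose (n + 1) = initSeg Y (n + 1) := by
      rcases Φ.output_comparable (h.choose_spec (n + 1)) (hY (n + 1)) with hc | hc
      · exact hc.eq_of_length hlen
      · exact (hc.eq_of_length hlen.symm).symm
    simp only [initSeg, List.map_inj_left, List.mem_range] at heq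
    exact heq n (Nat.lt_succ_self n)

/-- The semi-measure `λ_Φ` induced by `Φ`: `λ_Φ(σ) = λ {X | Φ^X ⪰ σ}`. -/
noncomputable def induced (Φ : TuringFunctional) (σ : BinStr) : ℝ :=
  uniformMeasure.real {X | σ ∈ Φ.output X}

end TuringFunctional

/-!
# No randomness ex nihilo for computable semi-measures

If `Φ` is total, the image under `Φ` of the complement of a component of a universal Martin-Löf test
is compact, and the complements of these images form a `ρ`-test, which a `ρ`-random `Y` has to pass.
If `Φ` is partial, the sets `{X | Φ^X ⪰ σ}` are only open, and this compactness argument breaks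
down. Computability of `ρ` repairs it: since `λ {X | Φ^X ⪰ σ} = ρ σ` is a computable real, one can
effectively find a clopen stage of each of these sets that exhausts it up to measure `2 ^ (-(σ + i
+ 1))` (`exists_computable_stage`), identifying `σ` with its code. What the stages leave out is,
uniformly in `i`, a c.e. open set of measure at most `2 ^ (-i)`. Adding it to a universal test
(`exists_universal_test`) gives c.e. open sets `⟦V i⟧` of measure at most `2 ^ (-i)` whose
complements contain only Martin-Löf random sequences, and relative to these complements every set
`{X | Φ^X ⪰ σ}` is clopen.

Let `W i` be the set of all `σ` with `{X | Φ^X ⪰ σ} ⊆ ⟦V i⟧`. By compactness this is a c.e.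
condition (`openOf_subset_iff_exists_covered`), and if `E i` is a prefix-free set with
`⟦E i⟧ = ⟦W i⟧` all of whose members extend members of `W i`, then the sets `{X | Φ^X ⪰ σ}` for
`σ ∈ E i` are disjoint subsets of `⟦V i⟧`, so that `ρ (E i) ≤ 2 ^ (-i)`
(`TuringFunctional.semimeasureOf_induced_le`). Thus `E` is a `ρ`-test, and a `ρ`-random `Y` avoids
some `⟦W i⟧`: no initial segment `σ` of `Y` has `{X | Φ^X ⪰ σ} ⊆ ⟦V i⟧`. A last appeal to
compactness gives an `X ∉ ⟦V i⟧` with `Φ^X ⪰ σ` for all these `σ`.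

All c.e. sets of strings are first replaced by primitive recursive prefix-free ones
(`exists_prefixFree`). For such a set `B` the measure of a finite stage of `⟦B⟧` is obtained by
counting strings (`uniformMeasure_openOf_truncate`), and what the stage leaves out is generated by
the longer strings of `B` (`PrefixFree.openOf_sdiff_truncate`).
-/

/-! ### Computable and computably enumerable predicates -/

section Computability

variable {α β : Type*} [Primcodable α] [Primcodable β]

theorem ComputablePred.comp_computable {p : β → Prop} {f : α → β} (hp : ComputablePred p)
    (hf : Computable f) : ComputablePred fun a => p (f a) := by
  obtain ⟨_, h⟩ := hp
  exact ⟨fun a => inferInstance, h.comp hf⟩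

theorem ComputablePred.and {p q : α → Prop} (hp : ComputablePred p) (hq : ComputablePred q) :
    ComputablePred fun a => p a ∧ q a := by
  obtain ⟨_, hp⟩ := hp
  obtain ⟨_, hq⟩ := hq
  exact ⟨fun a => inferInstance, (Primrec.and.to_comp.comp hp hq).of_eq fun a => by simp⟩

/-- The projection of a computable predicate is c.e. -/
theorem ComputablePred.exists_re {p : α × β → Prop} (hp : ComputablePred p) :
    REPred fun a => ∃ b, p (a, b) := by
  obtain ⟨_, hp⟩ := hp
  let g : α → ℕ → Bool := fun a n =>
    Option.casesOn (Encodable.decode (α := β) n) false fun b => decide (p (a, b))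
  have hg : Computable₂ g := by
    refine Computable.option_casesOn (o := fun x : α × ℕ => Encodable.decode (α := β) x.2)
      (Computable.decode.comp Computable.snd) (Computable.const false) ?_
    exact hp.comp (Computable.pair (Computable.fst.comp Computable.fst) Computable.snd)
  have hr : Partrec fun a => Nat.rfind (g a : ℕ →. Bool) := Partrec.rfind hg.partrec₂
  refine hr.dom_re.of_eq fun a => ?_
  rw [Nat.rfind_dom]
  constructor
  · rintro ⟨n, hn, -⟩
    have hn : g a n = true := (Part.mem_some_iff.1 hn).symm
    simp only [g] at hn
    rcases h : Encodable.decode (α := β) n with _ | b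
    · simp [h] at hn
    · exact ⟨b, by simpa [h] using hn⟩
  · rintro ⟨b, hb⟩
    exact ⟨Encodable.encode b, Part.mem_some_iff.2 (by simpa [g] using hb), fun _ => trivial⟩

/-- A c.e. predicate is the domain of the partial function computed by some code. -/
theorem REPred.exists_code {p : α → Prop} (hp : REPred p) :
    ∃ c : Nat.Partrec.Code, ∀ a, p a ↔
      ∃ s, (Nat.Partrec.Code.evaln s c (Encodable.encode a)).isSome := by
  obtain ⟨c, hc⟩ := Nat.Partrec.Code.exists_code.1 hp
  refine ⟨c, fun a => ?_⟩
  have h : p a ↔ ∃ x, x ∈ c.eval (Encodable.encode a) := by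
    rw [hc]
    simp [Part.bind, Part.assert]
  rw [h]
  simp only [Nat.Partrec.Code.evaln_complete, Option.isSome_iff_exists]
  exact exists_comm

theorem primrecPred_evaln_isSome :
    PrimrecPred fun x : (Nat.Partrec.Code × ℕ) × ℕ =>
      (Nat.Partrec.Code.evaln x.2 x.1.1 x.1.2).isSome = true :=
  Primrec.eq.comp (Primrec.option_isSome.comp (Nat.Partrec.Code.primrec_evaln.comp
    (Primrec.pair (Primrec.pair Primrec.snd (Primrec.fst.comp Primrec.fst))
      (Primrec.snd.comp Primrec.fst)))) (Primrec.const true)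

/-- A c.e. predicate is the projection of a primitive recursive one. -/
theorem REPred.exists_primrecPred {p : α → Prop} (hp : REPred p) :
    ∃ R : α × ℕ → Prop, PrimrecPred R ∧ ∀ a, p a ↔ ∃ s, R (a, s) := by
  obtain ⟨c, hc⟩ := hp.exists_code
  exact ⟨_, primrecPred_evaln_isSome.comp (f := fun x : α × ℕ => ((c, Encodable.encode x.1), x.2))
    (Primrec.pair (Primrec.pair (Primrec.const c) (Primrec.encode.comp Primrec.fst))
      Primrec.snd), hc⟩

theorem REPred.comp_computable {p : β → Prop}
    {f : α → β} (hp : REPred p) (hf : Computable f) : REPred fun a => p (f a) :=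
  Partrec.comp hp hf

theorem REPred.or {p q : α → Prop} (hp : REPred p) (hq : REPred q) :
    REPred fun a => p a ∨ q a := by
  obtain ⟨R, hR, hpR⟩ := hp.exists_primrecPred
  obtain ⟨S, hS, hqS⟩ := hq.exists_primrecPred
  refine (ComputablePred.exists_re (hR.or hS).computablePred).of_eq fun a => ?_
  rw [hpR, hqS, exists_or]

/-- Bounded existential quantification over a parameter of arbitrary type. -/
theorem PrimrecRel.exists_lt_of_primrec {R : ℕ → α → Prop} (hR : PrimrecRel R) {f : α → ℕ}
    (hf : Primrec f) : PrimrecPred fun a => ∃ n < f a, R n a :=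
  (hR.exists_mem_list.comp (Primrec.list_range.comp hf) Primrec.id).of_eq fun a => by simp

theorem Primrec.nat_pow : Primrec₂ ((· ^ ·) : ℕ → ℕ → ℕ) :=
  Primrec₂.unpaired'.1 Nat.Primrec.pow

end Computability

/-! ### Strings and cylinders -/

@[simp] theorem length_initSeg (X : Cantor) (n : ℕ) : (initSeg X n).length = n := by
  simp [initSeg]

theorem take_initSeg (X : Cantor) (k n : ℕ) : (initSeg X n).take k = initSeg X (min k n) := by
  simp [initSeg, ← List.map_take, List.take_range]

theorem take_initSeg_of_le {k n : ℕ} (X : Cantor) (h : k ≤ n) :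
    (initSeg X n).take k = initSeg X k := by
  rw [take_initSeg, min_eq_left h]

theorem initSeg_prefix {m n : ℕ} (X : Cantor) (h : m ≤ n) : initSeg X m <+: initSeg X n := by
  rw [← take_initSeg_of_le X h]
  exact List.take_prefix _ _

theorem mem_strCylinder {X : Cantor} {σ : BinStr} :
    X ∈ strCylinder σ ↔ initSeg X σ.length = σ := Iff.rfl

theorem mem_strCylinder_initSeg (X : Cantor) (n : ℕ) : X ∈ strCylinder (initSeg X n) := by
  simp [mem_strCylinder]

theorem mem_openOf {X : Cantor} {S : Set BinStr} :
    X ∈ openOf S ↔ ∃ n, initSeg X n ∈ S := by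
  simp only [openOf, Set.mem_iUnion, exists_prop]
  constructor
  · rintro ⟨σ, hσ, hX⟩
    exact ⟨σ.length, by rwa [mem_strCylinder.1 hX]⟩
  · rintro ⟨n, hn⟩
    exact ⟨_, hn, mem_strCylinder_initSeg X n⟩

theorem strCylinder_nonempty (σ : BinStr) : (strCylinder σ).Nonempty := by
  refine ⟨fun n => σ.getD n false, ?_⟩
  rw [mem_strCylinder]
  apply List.ext_getElem
  · simp
  · intro n h₁ h₂
    simp [initSeg, h₂]

theorem strCylinder_eq_pi (σ : BinStr) :
    strCylinder σ = Set.pi (Finset.range σ.length : Set ℕ) fun n => {σ.getD n false} := by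
  ext X
  rw [mem_strCylinder]
  constructor
  · intro h n hn
    have hn' : n < σ.length := by simpa using hn
    have := congrArg (fun l : BinStr => l.getD n false) h
    simpa [initSeg, hn'] using this
  · intro h
    apply List.ext_getElem
    · simp
    · intro n h₁ h₂
      have := h n (by simpa using h₂)
      simpa [initSeg, h₂] using this

theorem isClopen_strCylinder (σ : BinStr) : IsClopen (strCylinder σ) := by
  rw [strCylinder_eq_pi]
  exact ⟨isClosed_set_pi fun _ _ => isClosed_discrete _,
    isOpen_set_pi (Finset.finite_toSet _) fun _ _ => isOpen_discrete _⟩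

theorem isOpen_openOf (S : Set BinStr) : IsOpen (openOf S) :=
  isOpen_biUnion fun σ _ => (isClopen_strCylinder σ).isOpen

instance : IsProbabilityMeasure uniformMeasure := by
  unfold uniformMeasure
  infer_instance

theorem uniformMeasure_strCylinder (σ : BinStr) :
    uniformMeasure (strCylinder σ) = (2⁻¹ : ℝ≥0∞) ^ σ.length := by
  rw [strCylinder_eq_pi, uniformMeasure, Measure.infinitePi_pi _ fun _ _ =>
    measurableSet_singleton _]
  have h : ∀ b : Bool, (PMF.uniformOfFintype Bool).toMeasure {b} = 2⁻¹ := by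
    intro b
    rw [PMF.toMeasure_apply_singleton _ _ (measurableSet_singleton b)]
    simp
  simp [h]

theorem measurableSet_openOf (S : Set BinStr) : MeasurableSet (openOf S) :=
  (isOpen_openOf S).measurableSet

/-- The list of all strings of length `n`. -/
def stringsOfLength : ℕ → List BinStr
  | 0 => [[]]
  | n + 1 => (stringsOfLength n).flatMap fun l => [false :: l, true :: l]

theorem mem_stringsOfLength {n : ℕ} {σ : BinStr} : σ ∈ stringsOfLength n ↔ σ.length = n := by
  induction n generalizing σ with
  | zero => simp [stringsOfLength]
  | succ n ih =>
    rcases σ with _ | ⟨b, σ⟩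
    · simp [stringsOfLength]
    · cases b <;> simp [stringsOfLength, ih]

theorem nodup_stringsOfLength (n : ℕ) : (stringsOfLength n).Nodup := by
  induction n with
  | zero => simp [stringsOfLength]
  | succ n ih =>
    rw [stringsOfLength, List.nodup_flatMap]
    refine ⟨fun l _ => by simp, ih.imp fun {a b} hab => ?_⟩
    simp [Function.onFun, Ne.symm hab]

theorem primrec_stringsOfLength : Primrec stringsOfLength := by
  have h : Primrec₂ fun (_ : ℕ) (l : List BinStr) =>
      l.flatMap fun l : BinStr => [false :: l, true :: l] := by
    refine Primrec.list_flatMap Primrec.snd ?_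
    refine Primrec.list_cons.comp (Primrec.list_cons.comp (Primrec.const false) Primrec.snd)
      (Primrec.list_cons.comp (Primrec.list_cons.comp (Primrec.const true) Primrec.snd)
        (Primrec.const []))
  refine (Primrec.nat_rec₁ [[]] h).of_eq fun n => ?_
  induction n with
  | zero => rfl
  | succ n ih => simp only [stringsOfLength, ← ih]

/-! ### Finite stages of an open set -/

/-- The strings in `B` of length at most `n`. -/
def truncate (B : Set BinStr) (n : ℕ) : Set BinStr := {α ∈ B | α.length ≤ n}

/-- The string `β` has a prefix of length at most `n` in `B`. -/
def Covered (B : Set BinStr) (n : ℕ) (β : BinStr) : Prop := ∃ k < n + 1, β.take k ∈ B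

open Classical in
/-- The number of strings of length `n` with a prefix in `B`; the clopen set
`⟦truncate B n⟧` has measure `coverCount B n / 2 ^ n`. -/
noncomputable def coverCount (B : Set BinStr) (n : ℕ) : ℕ :=
  ((stringsOfLength n).filter (Covered B n ·)).length

theorem mem_openOf_truncate {B : Set BinStr} {n : ℕ} {X : Cantor} :
    X ∈ openOf (truncate B n) ↔ ∃ k ≤ n, initSeg X k ∈ B := by
  rw [mem_openOf]
  simp [truncate, and_comm]

theorem covered_initSeg {B : Set BinStr} {n m : ℕ} (h : n ≤ m) (X : Cantor) :
    Covered B n (initSeg X m) ↔ X ∈ openOf (truncate B n) := by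
  rw [mem_openOf_truncate]
  constructor
  · rintro ⟨k, hk, hB⟩
    exact ⟨k, by lia, by rwa [take_initSeg_of_le X (by lia)] at hB⟩
  · rintro ⟨k, hk, hB⟩
    exact ⟨k, by lia, by rwa [take_initSeg_of_le X (by lia)]⟩

theorem openOf_truncate_subset (B : Set BinStr) (n : ℕ) : openOf (truncate B n) ⊆ openOf B :=
  Set.biUnion_subset_biUnion_left fun _ h => h.1

theorem openOf_truncate_mono (B : Set BinStr) : Monotone fun n => openOf (truncate B n) :=
  fun _ _ h => Set.biUnion_subset_biUnion_left fun _ hα => ⟨hα.1, hα.2.trans h⟩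

theorem openOf_eq_iUnion_truncate (B : Set BinStr) : openOf B = ⋃ n, openOf (truncate B n) := by
  refine Set.Subset.antisymm (fun X hX => ?_) (Set.iUnion_subset (openOf_truncate_subset B))
  obtain ⟨n, hn⟩ := mem_openOf.1 hX
  exact Set.mem_iUnion.2 ⟨n, mem_openOf_truncate.2 ⟨n, le_rfl, hn⟩⟩

open Classical in
theorem openOf_truncate_eq_biUnion (B : Set BinStr) (n : ℕ) : openOf (truncate B n) =
    ⋃ β ∈ ((stringsOfLength n).filter (Covered B n ·)).toFinset, strCylinder β := by
  ext X
  simp only [List.mem_toFinset, List.mem_filter, mem_stringsOfLength, Set.mem_iUnion,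
    decide_eq_true_eq, exists_prop]
  constructor
  · intro hX
    exact ⟨initSeg X n, ⟨by simp, (covered_initSeg le_rfl X).2 hX⟩, mem_strCylinder_initSeg X n⟩
  · rintro ⟨β, ⟨rfl, hβ⟩, hX⟩
    rw [← mem_strCylinder.1 hX, length_initSeg] at hβ
    exact (covered_initSeg le_rfl X).1 hβ

theorem isClopen_openOf_truncate (B : Set BinStr) (n : ℕ) : IsClopen (openOf (truncate B n)) := by
  classical
  rw [openOf_truncate_eq_biUnion]
  exact isClopen_biUnion_finset fun β _ => isClopen_strCylinder β

theorem uniformMeasure_openOf_truncate (B : Set BinStr) (n : ℕ) :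
    uniformMeasure (openOf (truncate B n)) = coverCount B n * (2⁻¹ : ℝ≥0∞) ^ n := by
  classical
  rw [openOf_truncate_eq_biUnion, measure_biUnion_finset]
  · have h : ∀ β ∈ ((stringsOfLength n).filter (Covered B n ·)).toFinset,
        uniformMeasure (strCylinder β) = (2⁻¹ : ℝ≥0∞) ^ n := by
      intro β hβ
      rw [uniformMeasure_strCylinder]
      simp only [List.mem_toFinset, List.mem_filter, mem_stringsOfLength] at hβ
      rw [hβ.1]
    rw [Finset.sum_congr rfl h, Finset.sum_const, nsmul_eq_mul, coverCount,
      List.toFinset_card_of_nodup ((nodup_stringsOfLength n).filter _)]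
  · intro β hβ γ hγ hne
    simp only [Finset.mem_coe, List.mem_toFinset, List.mem_filter, mem_stringsOfLength] at hβ hγ
    refine Set.disjoint_left.2 fun X h₁ h₂ => hne ?_
    rw [← mem_strCylinder.1 h₁, ← mem_strCylinder.1 h₂, hβ.1, hγ.1]
  · exact fun β _ => (isClopen_strCylinder β).isOpen.measurableSet

theorem tendsto_uniformMeasure_openOf_truncate (B : Set BinStr) :
    Filter.Tendsto (fun n => uniformMeasure (openOf (truncate B n))) Filter.atTop
      (nhds (uniformMeasure (openOf B))) := by
  rw [openOf_eq_iUnion_truncate B]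
  exact tendsto_measure_iUnion_atTop (openOf_truncate_mono B)

section Primrec

variable {ι : Type*} [Primcodable ι]

theorem primrecPred_covered {B : ι → Set BinStr}
    (hB : PrimrecPred fun p : ι × BinStr => p.2 ∈ B p.1) :
    PrimrecPred fun p : BinStr × (ι × ℕ) => Covered (B p.2.1) p.2.2 p.1 := by
  have h : PrimrecRel fun (k : ℕ) (p : BinStr × (ι × ℕ)) => p.1.take k ∈ B p.2.1 :=
    hB.comp (f := fun x : ℕ × (BinStr × (ι × ℕ)) => (x.2.2.1, x.2.1.take x.1))
      (Primrec.pair (Primrec.fst.comp (Primrec.snd.comp Primrec.snd))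
        (Primrec.list_take.comp Primrec.fst (Primrec.fst.comp Primrec.snd)))
  exact h.exists_lt_of_primrec (Primrec.succ.comp (Primrec.snd.comp Primrec.snd))

theorem primrec_coverCount {B : ι → Set BinStr}
    (hB : PrimrecPred fun p : ι × BinStr => p.2 ∈ B p.1) :
    Primrec fun p : ι × ℕ => coverCount (B p.1) p.2 := by
  classical
  have h : PrimrecRel fun (β : BinStr) (p : ι × ℕ) => Covered (B p.1) p.2 β :=
    primrecPred_covered hB
  exact (Primrec.list_length.comp (h.listFilter.comp
    (primrec_stringsOfLength.comp Primrec.snd) Primrec.id)).of_eq fun p => by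
      simp only [coverCount]; congr!

end Primrec

/-! ### Prefix-free enumerations -/

/-- No member of `B` is a proper prefix of another one. -/
def PrefixFree (B : Set BinStr) : Prop := ∀ β ∈ B, ∀ β' ∈ B, β <+: β' → β = β'

theorem PrefixFree.eq_of_initSeg_mem {B : Set BinStr} (hB : PrefixFree B) {X : Cantor} {m n : ℕ}
    (hm : initSeg X m ∈ B) (hn : initSeg X n ∈ B) : m = n := by
  rcases le_total m n with h | h
  · simpa using congrArg List.length (hB _ hm _ hn (initSeg_prefix X h))
  · simpa using congrArg List.length (hB _ hn _ hm (initSeg_prefix X h)).symm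

/-- The strings of `B` that are longer than `n` describe the complement of the `n`-th stage. -/
theorem PrefixFree.openOf_sdiff_truncate {B : Set BinStr} (hB : PrefixFree B) (n : ℕ) :
    openOf {α ∈ B | n < α.length} = openOf B \ openOf (truncate B n) := by
  ext X
  rw [Set.mem_sdiff, mem_openOf_truncate, mem_openOf, mem_openOf]
  constructor
  · rintro ⟨k, hk, hnk⟩
    refine ⟨⟨k, hk⟩, ?_⟩
    rintro ⟨m, hm, hmB⟩
    have := hB.eq_of_initSeg_mem hk hmB
    simp at hnk
    lia
  · rintro ⟨⟨k, hk⟩, h⟩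
    refine ⟨k, hk, ?_⟩
    by_contra hlt
    exact h ⟨k, by simpa using hlt, hk⟩

/-- Every uniformly c.e. family of sets of strings can be replaced by a uniformly primitive
recursive family of prefix-free sets with the same open sets: a string `β` is put into the new
set when it is the shortest prefix of itself such that, within `|β|` steps, some prefix of `β`
has been enumerated. -/
theorem exists_prefixFree {ι : Type*} [Primcodable ι] {A : ι → Set BinStr}
    (hA : REPred fun p : ι × BinStr => p.2 ∈ A p.1) :
    ∃ B : ι → Set BinStr, (PrimrecPred fun p : ι × BinStr => p.2 ∈ B p.1) ∧
      ∀ i, PrefixFree (B i) ∧ (∀ β ∈ B i, ∃ α ∈ A i, α <+: β) ∧ openOf (B i) = openOf (A i) := by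
  obtain ⟨R, hR, hAR⟩ := hA.exists_primrecPred
  -- Some prefix of `β` is enumerated within `|β|` steps; this is inherited by extensions of `β`.
  let Hit : ι → BinStr → Prop := fun i β =>
    ∃ k < β.length + 1, ∃ s < β.length + 1, R ((i, β.take k), s)
  have hHit : PrimrecPred fun p : ι × BinStr => Hit p.1 p.2 := by
    have h₁ : PrimrecRel fun (s : ℕ) (x : ℕ × (ι × BinStr)) =>
        R ((x.2.1, x.2.2.take x.1), s) :=
      hR.comp (f := fun y : ℕ × (ℕ × (ι × BinStr)) => ((y.2.2.1, y.2.2.2.take y.2.1), y.1))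
        (Primrec.pair (Primrec.pair (Primrec.fst.comp (Primrec.snd.comp Primrec.snd))
          (Primrec.list_take.comp (Primrec.fst.comp Primrec.snd)
            (Primrec.snd.comp (Primrec.snd.comp Primrec.snd)))) Primrec.fst)
    have h₂ : PrimrecRel fun (k : ℕ) (p : ι × BinStr) =>
        ∃ s < p.2.length + 1, R ((p.1, p.2.take k), s) :=
      h₁.exists_lt_of_primrec (Primrec.succ.comp (Primrec.list_length.comp
        (Primrec.snd.comp Primrec.snd)))
    exact h₂.exists_lt_of_primrec (Primrec.succ.comp (Primrec.list_length.comp Primrec.snd))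
  have hmono : ∀ i β β', β <+: β' → Hit i β → Hit i β' := by
    rintro i β β' hβ ⟨k, hk, s, hs, hr⟩
    have hl := hβ.length_le
    refine ⟨k, by lia, s, by lia, ?_⟩
    rwa [List.prefix_iff_eq_take.1 hβ, List.take_take, min_eq_left (by lia)] at hr
  refine ⟨fun i => {β | Hit i β ∧ (β.length = 0 ∨ ¬ Hit i (β.take (β.length - 1)))}, ?_,
    fun i => ⟨?_, ?_, ?_⟩⟩
  · have hlen : Primrec fun p : ι × BinStr => p.2.length := Primrec.list_length.comp Primrec.snd
    exact hHit.and ((Primrec.eq.comp hlen (Primrec.const 0)).or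
      (hHit.comp (f := fun p : ι × BinStr => (p.1, p.2.take (p.2.length - 1)))
        (Primrec.pair Primrec.fst (Primrec.list_take.comp
          (Primrec.nat_sub.comp hlen (Primrec.const 1)) Primrec.snd))).not)
  · rintro β ⟨hβ, -⟩ β' ⟨-, hβ'⟩ hpre
    refine hpre.eq_of_length (hpre.length_le.antisymm ?_)
    by_contra hlt
    rcases hβ' with h0 | hn
    · lia
    · refine hn (hmono i β _ ?_ hβ)
      exact List.prefix_take_iff.2 ⟨hpre, by lia⟩
  · rintro β ⟨⟨k, -, s, -, hr⟩, -⟩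
    exact ⟨β.take k, (hAR (i, β.take k)).2 ⟨s, hr⟩, List.take_prefix _ _⟩
  · ext X
    rw [mem_openOf, mem_openOf]
    constructor
    · rintro ⟨n, ⟨k, -, s, -, hr⟩, -⟩
      rw [take_initSeg] at hr
      exact ⟨_, (hAR (i, _)).2 ⟨s, hr⟩⟩
    · rintro ⟨k, hk⟩
      obtain ⟨s, hs⟩ := (hAR (i, initSeg X k)).1 hk
      have hex : ∃ n, Hit i (initSeg X n) := by
        refine ⟨max k s, k, by simp, s, by simp, ?_⟩
        rwa [take_initSeg_of_le X (le_max_left _ _)]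
      classical
      refine ⟨Nat.find hex, Nat.find_spec hex, ?_⟩
      rw [length_initSeg, take_initSeg_of_le X (Nat.sub_le _ _)]
      rcases Nat.eq_zero_or_pos (Nat.find hex) with h | h
      · exact Or.inl h
      · exact Or.inr (Nat.find_min hex (Nat.sub_lt h one_pos))

/-! ### A universal Martin-Löf test -/

theorem uniformMeasure_openOf_truncate_le_iff (B : Set BinStr) (n j : ℕ) :
    uniformMeasure (openOf (truncate B n)) ≤ (2⁻¹ : ℝ≥0∞) ^ j ↔
      coverCount B n * 2 ^ j ≤ 2 ^ n := by
  have h : (coverCount B n * (2⁻¹ : ℝ≥0∞) ^ n) * 2 ^ j =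
      (coverCount B n * 2 ^ j : ℝ≥0∞) / 2 ^ n := by
    rw [← ENNReal.inv_pow, div_eq_mul_inv]
    ring
  rw [uniformMeasure_openOf_truncate, ← ENNReal.inv_pow (n := j), ENNReal.le_inv_iff_mul_le, h,
    ENNReal.div_le_iff (by simp) (by simp), one_mul]
  exact_mod_cast Iff.rfl

/-- The set `B`, with enumeration stopped before the stage at which the measure of the
enumerated open set exceeds `2 ^ (-j)`. -/
def trim (B : Set BinStr) (j : ℕ) : Set BinStr :=
  {α ∈ B | coverCount B α.length * 2 ^ j ≤ 2 ^ α.length}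

theorem uniformMeasure_openOf_trim_le (B : Set BinStr) (j : ℕ) :
    uniformMeasure (openOf (trim B j)) ≤ (2⁻¹ : ℝ≥0∞) ^ j := by
  -- Each stage of `trim B j` lies in a stage of `B` of small measure, or generates the empty set.
  refine le_of_tendsto' (tendsto_uniformMeasure_openOf_truncate _) fun n => ?_
  by_cases hs : ∃ m ≤ n, coverCount B m * 2 ^ j ≤ 2 ^ m ∧
      openOf (truncate (trim B j) n) ⊆ openOf (truncate B m)
  · obtain ⟨m, -, hm, hsub⟩ := hs
    exact (measure_mono hsub).trans ((uniformMeasure_openOf_truncate_le_iff B m j).2 hm)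
  · have hempty : openOf (truncate (trim B j) n) = ∅ := by
      induction n with
      | zero =>
        by_contra hne
        obtain ⟨X, hX⟩ := Set.nonempty_iff_ne_empty.2 hne
        obtain ⟨k, hk, hkX⟩ := mem_openOf_truncate.1 hX
        obtain rfl : k = 0 := by lia
        refine hs ⟨0, le_rfl, by simpa using hkX.2, ?_⟩
        exact Set.biUnion_subset_biUnion_left fun α hα => ⟨hα.1.1, hα.2⟩
      | succ n ih =>
        by_cases hn : coverCount B (n + 1) * 2 ^ j ≤ 2 ^ (n + 1)
        · exact absurd ⟨n + 1, le_rfl, hn,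
            Set.biUnion_subset_biUnion_left fun α hα => ⟨hα.1.1, hα.2⟩⟩ hs
        · have heq : truncate (trim B j) (n + 1) = truncate (trim B j) n := by
            ext α
            refine ⟨fun h => ⟨h.1, ?_⟩, fun h => ⟨h.1, h.2.trans n.le_succ⟩⟩
            by_contra hlt
            have : α.length = n + 1 := le_antisymm h.2 (by lia)
            exact hn (this ▸ h.1.2)
          rw [heq]
          refine ih ?_
          rintro ⟨m, hm, h⟩
          exact hs ⟨m, by lia, by rwa [heq]⟩
    simp [hempty]

theorem trim_eq_self {B : Set BinStr} {j : ℕ}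
    (h : uniformMeasure (openOf B) ≤ (2⁻¹ : ℝ≥0∞) ^ j) : trim B j = B :=
  Set.sep_eq_self_iff_mem_true.2 fun _ _ => (uniformMeasure_openOf_truncate_le_iff B _ j).1
    ((measure_mono (openOf_truncate_subset B _)).trans h)

/-- A countable family of sets of measures `2 ^ (-i-1)`, `2 ^ (-i-2)`, … covers a set of measure
at most `2 ^ (-i)`. -/
theorem measure_iUnion_le_of_encode {κ Ω : Type*} [Encodable κ] [MeasurableSpace Ω]
    (μ : Measure Ω) {S : κ → Set Ω} {i : ℕ}
    (h : ∀ e, μ (S e) ≤ (2⁻¹ : ℝ≥0∞) ^ (Encodable.encode e + i + 1)) :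
    μ (⋃ e, S e) ≤ (2⁻¹ : ℝ≥0∞) ^ i := calc
  μ (⋃ e, S e) ≤ ∑' e, μ (S e) := measure_iUnion_le _
  _ ≤ ∑' e : κ, (2⁻¹ : ℝ≥0∞) ^ (Encodable.encode e + i + 1) := ENNReal.tsum_le_tsum h
  _ ≤ ∑' n : ℕ, (2⁻¹ : ℝ≥0∞) ^ (n + i + 1) :=
    ENNReal.tsum_comp_le_tsum_of_injective (f := fun e : κ => Encodable.encode e)
      Encodable.encode_injective (fun n => (2⁻¹ : ℝ≥0∞) ^ (n + i + 1))
  _ = (2⁻¹ : ℝ≥0∞) ^ i := by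
    simp_rw [add_assoc, pow_add _ _ (i + 1)]
    rw [ENNReal.tsum_mul_right, ENNReal.tsum_geometric, ENNReal.one_sub_inv_two, inv_inv,
      pow_succ, mul_left_comm, ENNReal.mul_inv_cancel (by simp) (by simp), mul_one]

/-- There is a universal Martin-Löf test: its `i`-th component collects, over all codes `e`, the
trimmed `(e + i + 1)`-st component of the `e`-th uniformly c.e. sequence. -/
theorem exists_universal_test : ∃ T : ℕ → Set BinStr, UniformlyCE T ∧
    (∀ i, uniformMeasure (openOf (T i)) ≤ (2⁻¹ : ℝ≥0∞) ^ i) ∧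
    ∀ X ∉ MLR, ∀ i, X ∈ openOf (T i) := by
  let A : Nat.Partrec.Code × ℕ → Set BinStr := fun x =>
    {α | ∃ s, (Nat.Partrec.Code.evaln s x.1 (Encodable.encode (x.2, α))).isSome}
  have hA : REPred fun p : (Nat.Partrec.Code × ℕ) × BinStr => p.2 ∈ A p.1 :=
    ComputablePred.exists_re (primrecPred_evaln_isSome.comp
      (f := fun x : ((Nat.Partrec.Code × ℕ) × BinStr) × ℕ =>
        ((x.1.1.1, Encodable.encode (x.1.1.2, x.1.2)), x.2))
      (Primrec.pair (Primrec.pair (Primrec.fst.comp (Primrec.fst.comp Primrec.fst))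
        (Primrec.encode.comp (Primrec.pair (Primrec.snd.comp (Primrec.fst.comp Primrec.fst))
          (Primrec.snd.comp Primrec.fst)))) Primrec.snd)).computablePred
  obtain ⟨B, hB, hBA⟩ := exists_prefixFree hA
  have htrim : PrimrecPred fun y : ((Nat.Partrec.Code × ℕ) × BinStr) =>
      y.2 ∈ trim (B y.1) y.1.2 := by
    have hlen : Primrec fun y : (Nat.Partrec.Code × ℕ) × BinStr => y.2.length :=
      Primrec.list_length.comp Primrec.snd
    exact hB.and (Primrec.nat_le.comp
      (Primrec.nat_mul.comp ((primrec_coverCount hB).comp (Primrec.pair Primrec.fst hlen))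
        (Primrec.nat_pow.comp (Primrec.const 2) (Primrec.snd.comp Primrec.fst)))
      (Primrec.nat_pow.comp (Primrec.const 2) hlen))
  refine ⟨fun i => {α | ∃ e : Nat.Partrec.Code,
    α ∈ trim (B (e, Encodable.encode e + i + 1)) (Encodable.encode e + i + 1)}, ?_, ?_, ?_⟩
  · refine ComputablePred.exists_re (htrim.comp (f := fun x : (ℕ × BinStr) × Nat.Partrec.Code =>
      ((x.2, Encodable.encode x.2 + x.1.1 + 1), x.1.2)) ?_).computablePred
    exact Primrec.pair (Primrec.pair Primrec.snd (Primrec.succ.comp (Primrec.nat_add.comp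
      (Primrec.encode.comp Primrec.snd) (Primrec.fst.comp Primrec.fst))))
      (Primrec.snd.comp Primrec.fst)
  · intro i
    refine le_trans (measure_mono fun X hX => ?_) (measure_iUnion_le_of_encode uniformMeasure
      fun e : Nat.Partrec.Code => uniformMeasure_openOf_trim_le
        (B (e, Encodable.encode e + i + 1)) (Encodable.encode e + i + 1))
    obtain ⟨n, e, hn⟩ := mem_openOf.1 hX
    exact Set.mem_iUnion.2 ⟨e, mem_openOf.2 ⟨n, hn⟩⟩
  · intro X hX i
    simp only [MLR, Set.mem_ofPred_eq, not_forall, not_not] at hX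
    obtain ⟨U, hU, hmeas, hXU⟩ := hX
    obtain ⟨e, he⟩ := hU.exists_code
    have hopen : ∀ j, openOf (B (e, j)) = openOf (U j) := fun j => by
      rw [(hBA (e, j)).2.2]
      congr 1
      ext α
      exact (he (j, α)).symm
    have hX' := Set.mem_iInter.1 hXU (Encodable.encode e + i + 1)
    rw [← hopen, ← trim_eq_self ((congrArg uniformMeasure (hopen _)).trans_le (hmeas _))] at hX'
    obtain ⟨n, hn⟩ := mem_openOf.1 hX'
    exact mem_openOf.2 ⟨n, e, hn⟩

/-! ### Preimages of cylinders under a Turing functional -/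

/-- The open sets `{X | Φ^X ⪰ σ}` are generated by a uniformly primitive recursive family of
prefix-free sets. -/
theorem TuringFunctional.exists_prefixFree_preimage (Φ : TuringFunctional) :
    ∃ G : BinStr → Set BinStr, (PrimrecPred fun p : BinStr × BinStr => p.2 ∈ G p.1) ∧
      ∀ σ, PrefixFree (G σ) ∧ openOf (G σ) = {X | σ ∈ Φ.output X} := by
  let A : BinStr → Set BinStr := fun σ => {α | σ = [] ∨ ∃ ν, (α, σ ++ ν) ∈ Φ.pairs}
  have hA : REPred fun p : BinStr × BinStr => p.2 ∈ A p.1 := by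
    have hnil : PrimrecPred fun p : BinStr × BinStr => p.1 = [] :=
      Primrec.eq.comp Primrec.fst (Primrec.const [])
    refine hnil.computablePred.to_re.or ?_
    obtain ⟨R, hR, hΦ⟩ := Φ.ce.exists_primrecPred
    refine (ComputablePred.exists_re (β := BinStr × ℕ) (hR.comp
      (f := fun x : (BinStr × BinStr) × (BinStr × ℕ) => ((x.1.2, x.1.1 ++ x.2.1), x.2.2))
      (Primrec.pair (Primrec.pair (Primrec.snd.comp Primrec.fst)
        (Primrec.list_append.comp (Primrec.fst.comp Primrec.fst) (Primrec.fst.comp Primrec.snd)))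
        (Primrec.snd.comp Primrec.snd))).computablePred).of_eq fun p => ?_
    simp only [Prod.exists, hΦ]
  obtain ⟨G, hG, h⟩ := exists_prefixFree hA
  refine ⟨G, hG, fun σ => ⟨(h σ).1, (h σ).2.2.trans ?_⟩⟩
  ext X
  rw [mem_openOf]
  constructor
  · rintro ⟨n, rfl | ⟨ν, hν⟩⟩
    · exact Or.inl rfl
    · exact Or.inr ⟨_, _, hν, mem_strCylinder_initSeg X n, List.prefix_append σ ν⟩
  · rintro (rfl | ⟨α, _, hp, hX, ν, rfl⟩)
    · exact ⟨0, Or.inl rfl⟩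
    · exact ⟨α.length, Or.inr ⟨ν, by rwa [mem_strCylinder.1 hX]⟩⟩

theorem TuringFunctional.mem_output_of_prefix (Φ : TuringFunctional) {σ τ : BinStr} {X : Cantor}
    (h : σ <+: τ) (hτ : τ ∈ Φ.output X) : σ ∈ Φ.output X := by
  rcases hτ with rfl | ⟨α, τ', hp, hX, hpre⟩
  · exact Or.inl (List.prefix_nil.1 h)
  · exact Or.inr ⟨α, τ', hp, hX, h.trans hpre⟩

/-- The `λ_Φ`-weight of a prefix-free set is at most the measure of any set that contains the
preimages of its members. -/
theorem TuringFunctional.semimeasureOf_induced_le (Φ : TuringFunctional) {E : Set BinStr}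
    (hE : PrefixFree E) {S : Set Cantor} (hS : ∀ σ ∈ E, {X | σ ∈ Φ.output X} ⊆ S) :
    semimeasureOf Φ.induced E ≤ uniformMeasure S := by
  obtain ⟨G, -, hG⟩ := Φ.exists_prefixFree_preimage
  have hmeas : ∀ σ, MeasurableSet {X | σ ∈ Φ.output X} := fun σ => by
    rw [← (hG σ).2]
    exact measurableSet_openOf _
  have h : semimeasureOf Φ.induced E =
      uniformMeasure (⋃ σ : E, {X | (σ : BinStr) ∈ Φ.output X}) := by
    rw [measure_iUnion (f := fun σ : E => {X | (σ : BinStr) ∈ Φ.output X}) ?_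
      fun σ => hmeas σ]
    · exact tsum_congr fun σ => ENNReal.ofReal_toReal (measure_ne_top _ _)
    · intro σ τ hne
      refine Set.disjoint_left.2 fun X h₁ h₂ => hne (Subtype.ext ?_)
      rcases Φ.output_comparable h₁ h₂ with h | h
      · exact hE _ σ.2 _ τ.2 h
      · exact (hE _ τ.2 _ σ.2 h).symm
  rw [h]
  exact measure_mono (Set.iUnion_subset fun σ => hS σ σ.2)

/-! ### Effective approximation of the preimages -/

/-- If the measures of the open sets `⟦G σ⟧` are computable, then stages that
exhaust `⟦G σ⟧` up to measure `2 ^ (-(σ + i + 1))`, with `σ` identified with its code, can be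
recognized effectively. -/
theorem exists_computable_stage {ρ : BinStr → ℝ} (hρ : IsComputableSemimeasure ρ)
    {G : BinStr → Set BinStr} (hG : PrimrecPred fun p : BinStr × BinStr => p.2 ∈ G p.1)
    (hGρ : ∀ σ, uniformMeasure.real (openOf (G σ)) = ρ σ) :
    ∃ Good : (ℕ × BinStr) × ℕ → Prop, ComputablePred Good ∧ ∀ i σ,
      (∃ n, Good ((i, σ), n)) ∧ ∀ n, Good ((i, σ), n) →
        uniformMeasure (openOf (G σ) \ openOf (truncate (G σ) n)) ≤
          (2⁻¹ : ℝ≥0∞) ^ (Encodable.encode σ + i + 1) := by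
  obtain ⟨f, hf, happ⟩ := hρ.approx
  -- With `k = σ + i + 3`, approximating `ρ σ` and comparing it with a stage costs at most
  -- `3 * 2 ^ (-k)`, which is less than `4 * 2 ^ (-k) = 2 ^ (-(σ + i + 1))`.
  let K : (ℕ × BinStr) × ℕ → ℕ := fun x => Encodable.encode x.1.2 + x.1.1 + 3
  have hK : Primrec K := Primrec.nat_add.comp (Primrec.nat_add.comp
    (Primrec.encode.comp (Primrec.snd.comp Primrec.fst)) (Primrec.fst.comp Primrec.fst))
    (Primrec.const 3)
  -- `Q (m, b) ((c, n), k)` says `m / 2 ^ b ≤ c / 2 ^ n + 2 / 2 ^ k`, cleared of denominators.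
  let Q : (ℕ × ℕ) × ((ℕ × ℕ) × ℕ) → Prop := fun y =>
    y.1.1 * (2 ^ y.2.1.2 * 2 ^ y.2.2) ≤
      2 ^ y.1.2 * (y.2.1.1 * 2 ^ y.2.2 + 2 * 2 ^ y.2.1.2)
  have hQ : PrimrecPred Q := by
    have hpow : ∀ {g : (ℕ × ℕ) × ((ℕ × ℕ) × ℕ) → ℕ}, Primrec g → Primrec fun y => 2 ^ g y :=
      fun hg => Primrec.nat_pow.comp (Primrec.const 2) hg
    have hn : Primrec fun y : (ℕ × ℕ) × ((ℕ × ℕ) × ℕ) => 2 ^ y.2.1.2 :=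
      hpow (Primrec.snd.comp (Primrec.fst.comp Primrec.snd))
    have hk : Primrec fun y : (ℕ × ℕ) × ((ℕ × ℕ) × ℕ) => 2 ^ y.2.2 :=
      hpow (Primrec.snd.comp Primrec.snd)
    exact Primrec.nat_le.comp
      (Primrec.nat_mul.comp (Primrec.fst.comp Primrec.fst) (Primrec.nat_mul.comp hn hk))
      (Primrec.nat_mul.comp (hpow (Primrec.snd.comp Primrec.fst))
        (Primrec.nat_add.comp
          (Primrec.nat_mul.comp (Primrec.fst.comp (Primrec.fst.comp Primrec.snd)) hk)
          (Primrec.nat_mul.comp (Primrec.const 2) hn)))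
  have hQ_iff : ∀ m b c n k : ℕ, Q ((m, b), ((c, n), k)) ↔
      (m : ℝ) / 2 ^ b ≤ c / 2 ^ n + 2 * (1 / 2) ^ k := by
    intro m b c n k
    have h : (c : ℝ) / 2 ^ n + 2 * (1 / 2) ^ k = (c * 2 ^ k + 2 * 2 ^ n) / (2 ^ n * 2 ^ k) := by
      rw [one_div, inv_pow]
      field_simp
    rw [h, div_le_div_iff₀ (by positivity) (by positivity), mul_comm _ ((2 : ℝ) ^ b)]
    simp only [Q]
    exact_mod_cast Iff.rfl
  have hreal : ∀ σ n, uniformMeasure.real (openOf (truncate (G σ) n)) =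
      (coverCount (G σ) n : ℝ) / 2 ^ n := fun σ n => by
    rw [measureReal_def, uniformMeasure_openOf_truncate]
    simp [div_eq_mul_inv]
  refine ⟨fun x => Q (f (x.1.2, K x), ((coverCount (G x.1.2) x.2, x.2), K x)), ?_, ?_⟩
  · refine hQ.computablePred.comp_computable (Computable.pair
      (hf.comp (Computable.pair (Computable.snd.comp Computable.fst) hK.to_comp)) ?_)
    exact (Primrec.pair (Primrec.pair ((primrec_coverCount hG).comp
      (Primrec.pair (Primrec.snd.comp Primrec.fst) Primrec.snd)) Primrec.snd) hK).to_comp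
  intro i σ
  set k : ℕ := Encodable.encode σ + i + 3 with hk
  have hKk : ∀ n, K ((i, σ), n) = k := fun n => rfl
  have hpos : (0 : ℝ) < (1 / 2) ^ k := by positivity
  have ha := abs_le.1 (happ σ k)
  constructor
  · have ht := (ENNReal.tendsto_toReal (measure_ne_top _ _)).comp
      (tendsto_uniformMeasure_openOf_truncate (G σ))
    obtain ⟨n, hn⟩ := (ht.eventually (lt_mem_nhds (a := ρ σ - (1 / 2) ^ k) (by
      rw [← measureReal_def, hGρ]; linarith))).exists
    have hn : ρ σ - (1 / 2) ^ k < uniformMeasure.real (openOf (truncate (G σ) n)) := hn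
    refine ⟨n, (hQ_iff _ _ _ _ _).2 ?_⟩
    rw [hreal] at hn
    simp only [hKk]
    linarith [ha.1]
  · intro n hn
    have hn := (hQ_iff _ _ _ _ _).1 hn
    simp only [hKk] at hn
    rw [← hreal] at hn
    have hd : uniformMeasure.real (openOf (G σ) \ openOf (truncate (G σ) n)) =
        ρ σ - uniformMeasure.real (openOf (truncate (G σ) n)) := by
      rw [measureReal_sdiff (openOf_truncate_subset _ _) (measurableSet_openOf _), hGρ]
    have hle : uniformMeasure.real (openOf (G σ) \ openOf (truncate (G σ) n)) ≤
        (1 / 2) ^ (Encodable.encode σ + i + 1) := by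
      have : (1 / 2 : ℝ) ^ (Encodable.encode σ + i + 1) = 4 * (1 / 2) ^ k := by
        rw [hk, show Encodable.encode σ + i + 3 = Encodable.encode σ + i + 1 + 2 by lia, pow_add]
        ring
      rw [hd, this]
      linarith [ha.2]
    rw [← ofReal_measureReal, show (2⁻¹ : ℝ≥0∞) = ENNReal.ofReal (1 / 2) by
      rw [one_div, ENNReal.ofReal_inv_of_pos two_pos, ENNReal.ofReal_ofNat],
      ← ENNReal.ofReal_pow (by norm_num)]
    exact ENNReal.ofReal_le_ofReal hle

/-! ### Random preimages of random sequences -/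

/-- If `⟦V⟧` contains the part of `⟦G⟧` that is missing from its `n`-th stage, then finitely many
strings witness the inclusion of `⟦G⟧` in `⟦V⟧`. -/
theorem openOf_subset_iff_exists_covered {G V : Set BinStr} {n : ℕ}
    (h : openOf G \ openOf (truncate G n) ⊆ openOf V) :
    openOf G ⊆ openOf V ↔ ∃ d, ∀ β ∈ stringsOfLength (n + d),
      ¬ Covered G n β ∨ Covered V (n + d) β := by
  constructor
  · intro hsub
    obtain ⟨m, hm⟩ := (isClopen_openOf_truncate G n).isClosed.isCompact.elim_directed_cover
      (fun m => openOf (truncate V m)) (fun m => isOpen_openOf _)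
      (by rw [← openOf_eq_iUnion_truncate]; exact (openOf_truncate_subset G n).trans hsub)
      (openOf_truncate_mono V).directed_le
    refine ⟨m, fun β hβ => or_iff_not_imp_left.2 fun hcov => ?_⟩
    obtain ⟨X, hX⟩ := strCylinder_nonempty β
    rw [← mem_strCylinder.1 hX, mem_stringsOfLength.1 hβ] at hcov ⊢
    rw [not_not, covered_initSeg (Nat.le_add_right _ _)] at hcov
    rw [covered_initSeg le_rfl]
    exact openOf_truncate_mono V (Nat.le_add_left m n) (hm hcov)
  · rintro ⟨d, hd⟩ X hX
    by_cases hXn : X ∈ openOf (truncate G n)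
    · rcases hd (initSeg X (n + d)) (mem_stringsOfLength.2 (by simp)) with hc | hc
      · exact absurd ((covered_initSeg (Nat.le_add_right n d) X).2 hXn) hc
      · exact openOf_truncate_subset _ _ ((covered_initSeg le_rfl X).1 hc)
    · exact h ⟨hX, hXn⟩

theorem mainTheorem2 (Φ : TuringFunctional) (ρ : BinStr → ℝ)
    (hρ : IsComputableSemimeasure ρ) (hind : Φ.induced = ρ)
    (Y : Cantor) (hY : Y ∈ SemimeasureMLR ρ) :
    ∃ X ∈ MLR, Y ∈ Φ.eval X := by
  obtain ⟨G, hG, hGΦ⟩ := Φ.exists_prefixFree_preimage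
  obtain ⟨T, hT, hTmeas, hTuniv⟩ := exists_universal_test
  obtain ⟨Good, hGood, hstage⟩ := exists_computable_stage hρ hG fun σ => by
    rw [(hGΦ σ).2, ← hind]
    rfl
  -- The tails `⟦G σ⟧ \ ⟦truncate (G σ) n⟧` at good stages, which are added to the universal test.
  let L : ℕ → Set BinStr := fun i =>
    {α | ∃ x : BinStr × ℕ, Good ((i, x.1), x.2) ∧ α ∈ G x.1 ∧ x.2 < α.length}
  have hL : UniformlyCE L := by
    refine ComputablePred.exists_re (β := BinStr × ℕ)
      (p := fun y : (ℕ × BinStr) × (BinStr × ℕ) => Good ((y.1.1, y.2.1), y.2.2) ∧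
        y.1.2 ∈ G y.2.1 ∧ y.2.2 < y.1.2.length) (.and ?_ (PrimrecPred.computablePred (.and ?_ ?_)))
    · exact hGood.comp_computable (f := fun y : (ℕ × BinStr) × (BinStr × ℕ) =>
        ((y.1.1, y.2.1), y.2.2)) (Primrec.pair (Primrec.pair (Primrec.fst.comp Primrec.fst)
          (Primrec.fst.comp Primrec.snd)) (Primrec.snd.comp Primrec.snd)).to_comp
    · exact hG.comp (f := fun y : (ℕ × BinStr) × (BinStr × ℕ) => (y.2.1, y.1.2))
        (Primrec.pair (Primrec.fst.comp Primrec.snd) (Primrec.snd.comp Primrec.fst))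
    · exact Primrec.nat_lt.comp (Primrec.snd.comp Primrec.snd)
        (Primrec.list_length.comp (Primrec.snd.comp Primrec.fst))
  have hLtail : ∀ i σ n, Good ((i, σ), n) →
      openOf (G σ) \ openOf (truncate (G σ) n) ⊆ openOf (L i) := by
    intro i σ n hn
    rw [← (hGΦ σ).1.openOf_sdiff_truncate]
    exact Set.biUnion_subset_biUnion_left fun α hα => ⟨(σ, n), hn, hα⟩
  have hLmeas : ∀ i, uniformMeasure (openOf (L i)) ≤ (2⁻¹ : ℝ≥0∞) ^ i := by
    intro i
    classical
    refine le_trans (measure_mono fun X hX => ?_) (measure_iUnion_le_of_encode uniformMeasure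
      fun σ : BinStr => (hstage i σ).2 _ (Nat.find_spec (hstage i σ).1))
    obtain ⟨k, ⟨σ, n⟩, hn, hk, hlt⟩ := mem_openOf.1 hX
    refine Set.mem_iUnion.2 ⟨σ, ?_⟩
    rw [← (hGΦ σ).1.openOf_sdiff_truncate]
    exact mem_openOf.2 ⟨k, hk, (Nat.find_min' _ hn).trans_lt hlt⟩
  have hsucc : Computable fun p : ℕ × BinStr => (p.1 + 1, p.2) :=
    (Primrec.pair (Primrec.succ.comp Primrec.fst) Primrec.snd).to_comp
  have hV : UniformlyCE fun i => T (i + 1) ∪ L (i + 1) :=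
    .or (.comp_computable (p := fun p : ℕ × BinStr => p.2 ∈ T p.1) hT hsucc)
      (.comp_computable (p := fun p : ℕ × BinStr => p.2 ∈ L p.1) hL hsucc)
  obtain ⟨V, hVprim, hVTL⟩ := exists_prefixFree (A := fun i => T (i + 1) ∪ L (i + 1)) hV
  have hVopen : ∀ i, openOf (V i) = openOf (T (i + 1)) ∪ openOf (L (i + 1)) := fun i =>
    (hVTL i).2.2.trans (Set.biUnion_union _ _ _)
  have hVmeas : ∀ i, uniformMeasure (openOf (V i)) ≤ (2⁻¹ : ℝ≥0∞) ^ i := by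
    intro i
    rw [hVopen]
    refine (measure_union_le _ _).trans ((add_le_add (hTmeas _) (hLmeas _)).trans_eq ?_)
    rw [pow_succ, ← mul_add, ENNReal.inv_two_add_inv_two, mul_one]
  have hVtail : ∀ i σ n, Good ((i + 1, σ), n) →
      openOf (G σ) \ openOf (truncate (G σ) n) ⊆ openOf (V i) := by
    intro i σ n hn
    rw [hVopen]
    exact (hLtail _ σ n hn).trans Set.subset_union_right
  -- The strings whose preimage is contained in `⟦V i⟧`.
  let W : ℕ → Set BinStr := fun i => {σ | openOf (G σ) ⊆ openOf (V i)}
  have hW : UniformlyCE W := by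
    have hcov : PrimrecRel fun (β : BinStr) (x : (ℕ × BinStr) × (ℕ × ℕ)) =>
        ¬ Covered (G x.1.2) x.2.1 β ∨ Covered (V x.1.1) (x.2.1 + x.2.2) β := by
      refine PrimrecPred.or (PrimrecPred.not ?_) ?_
      · exact (primrecPred_covered hG).comp
          (f := fun y : BinStr × ((ℕ × BinStr) × (ℕ × ℕ)) => (y.1, (y.2.1.2, y.2.2.1)))
          (Primrec.pair Primrec.fst (Primrec.pair
            (Primrec.snd.comp (Primrec.fst.comp Primrec.snd))
            (Primrec.fst.comp (Primrec.snd.comp Primrec.snd))))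
      · exact (primrecPred_covered hVprim).comp
          (f := fun y : BinStr × ((ℕ × BinStr) × (ℕ × ℕ)) =>
            (y.1, (y.2.1.1, y.2.2.1 + y.2.2.2)))
          (Primrec.pair Primrec.fst (Primrec.pair
            (Primrec.fst.comp (Primrec.fst.comp Primrec.snd))
            (Primrec.nat_add.comp (Primrec.fst.comp (Primrec.snd.comp Primrec.snd))
              (Primrec.snd.comp (Primrec.snd.comp Primrec.snd)))))
    have hall : PrimrecPred fun x : (ℕ × BinStr) × (ℕ × ℕ) =>
        ∀ β ∈ stringsOfLength (x.2.1 + x.2.2),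
          ¬ Covered (G x.1.2) x.2.1 β ∨ Covered (V x.1.1) (x.2.1 + x.2.2) β :=
      hcov.forall_mem_list.comp (primrec_stringsOfLength.comp (Primrec.nat_add.comp
        (Primrec.fst.comp Primrec.snd) (Primrec.snd.comp Primrec.snd))) Primrec.id
    have hgood : ComputablePred fun x : (ℕ × BinStr) × (ℕ × ℕ) =>
        Good ((x.1.1 + 1, x.1.2), x.2.1) :=
      hGood.comp_computable (Primrec.pair (Primrec.pair
        (Primrec.succ.comp (Primrec.fst.comp Primrec.fst)) (Primrec.snd.comp Primrec.fst))
        (Primrec.fst.comp Primrec.snd)).to_comp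
    refine (ComputablePred.exists_re (hgood.and hall.computablePred)).of_eq fun ⟨i, σ⟩ => ?_
    simp only [Prod.exists, exists_and_left]
    constructor
    · rintro ⟨n, hn, hd⟩
      exact (openOf_subset_iff_exists_covered (hVtail i σ n hn)).2 hd
    · intro hσ
      obtain ⟨n, hn⟩ := (hstage (i + 1) σ).1
      exact ⟨n, hn, (openOf_subset_iff_exists_covered (hVtail i σ n hn)).1 hσ⟩
  obtain ⟨E, hE, hEW⟩ := exists_prefixFree (A := W) hW
  have hEmeas : ∀ i, semimeasureOf ρ (E i) ≤ (2⁻¹ : ℝ≥0∞) ^ i := by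
    intro i
    rw [← hind]
    refine (Φ.semimeasureOf_induced_le (hEW i).1 fun τ hτ => ?_).trans (hVmeas i)
    obtain ⟨σ, hσ, hpre⟩ := (hEW i).2.1 τ hτ
    have hσ : openOf (G σ) ⊆ openOf (V i) := hσ
    rw [(hGΦ σ).2] at hσ
    exact fun X hX => hσ (Φ.mem_output_of_prefix hpre hX)
  obtain ⟨i, hi⟩ : ∃ i, Y ∉ openOf (W i) := by
    have := hY E hE.computablePred.to_re hEmeas
    simpa [(hEW _).2.2] using this
  have hYW : ∀ k, ¬ openOf (G (initSeg Y k)) ⊆ openOf (V i) := fun k hk =>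
    hi (mem_openOf.2 ⟨k, hk⟩)
  -- Outside `⟦V i⟧` the preimages of the cylinders around `Y` are closed, and none is empty.
  choose n hn using fun k => (hstage (i + 1) (initSeg Y k)).1
  have hclosed : ∀ k, openOf (G (initSeg Y k)) ∩ (openOf (V i))ᶜ =
      openOf (truncate (G (initSeg Y k)) (n k)) ∩ (openOf (V i))ᶜ := by
    intro k
    refine Set.Subset.antisymm (fun X hX => ⟨?_, hX.2⟩)
      (Set.inter_subset_inter_left _ (openOf_truncate_subset _ _))
    by_contra hXn
    exact hX.2 (hVtail i _ _ (hn k) ⟨hX.1, hXn⟩)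
  have hcl : ∀ k, IsClosed (openOf (G (initSeg Y k)) ∩ (openOf (V i))ᶜ) := fun k => by
    rw [hclosed]
    exact (isClopen_openOf_truncate _ _).isClosed.inter (isOpen_openOf _).isClosed_compl
  obtain ⟨X, hX⟩ := IsCompact.nonempty_iInter_of_sequence_nonempty_isCompact_isClosed
    (fun k => openOf (G (initSeg Y k)) ∩ (openOf (V i))ᶜ)
    (fun k X hX => ⟨by
      have h := hX.1
      rw [(hGΦ _).2] at h ⊢
      exact Φ.mem_output_of_prefix (initSeg_prefix Y k.le_succ) h, hX.2⟩)
    (fun k => Set.not_subset.1 (hYW k)) (hcl 0).isCompact hcl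
  rw [Set.mem_iInter] at hX
  refine ⟨X, ?_, (Φ.mem_eval_iff X Y).2 fun k => ?_⟩
  · by_contra hXR
    refine (hX 0).2 ?_
    rw [hVopen]
    exact Or.inl (hTuniv X hXR _)
  · have h := (hX k).1
    rwa [(hGΦ _).2] at h
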